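/- Let $H$ be a complex Hilbert space with scalar product $(\cdot,\cdot)$ linear in its first and conjugate-linear in its second argument. Let $\{\mathcal U(t)\}_{t\ge 0}$ be a strongly continuous semigroup of bounded linear operators on $H$ with generator $\mathcal L x=\lim_{h\searrow 0}\frac1h[\mathcal U(h)x-x]$, whose domain $D(\mathcal L)$ is the set of all $x\in H$ for which this limit exists, and let $\mathcal L^\dagger$ be the adjoint of $\mathcal L$. Let $0\ne z\in D(\mathcal L)\cap D(\mathcal L^\dagger)$, and put $\mathcal P x=(x,z)(z,z)^{-1}z$ and $\mathcal Q=1-\mathcal P$. Then the operator $\mathcal{QL}$ with domain $D(\mathcal L)$ is closable, and with $\overline{\mathcal{QL}}$ denoting its closure, the operator $\overline{\mathcal{QL}}\mathcal Q$ with domain $\{x\in H : \mathcal Qx\in D(\overline{\mathcal{QL}})\}$ is the generator of a strongly continuous semigroup $\{\mathcal G(t)\}_{t\ge 0}$ on $H$. Consider the system of equations $$\frac{d}{dt}\mathcal U(t)z=\mathcal U(t)\mathcal{PL}z+\eta_t+\int_0^t K(t-s)\,\mathcal U(s)z\,ds,\qquad K(t)=(\eta_t,\mathcal Q\mathcal L^\dagger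 z)(z,z)^{-1}\qquad (t\ge 0)$$ for a locally integrable $K\colon[0,\infty)\to\mathbb C$ and a function $\eta\colon[0,\infty)\to H$ (the derivative at $t=0$ is the right derivative). This system has a solution, and for every solution $(K,\eta)$ the fluctuating forces $\eta_t$ satisfy, for all $t\ge 0$, $$\eta_t=\mathcal G(t)\mathcal{QL}z ,$$ where $\{\mathcal G(t)\}_{t\ge0}$ is the strongly continuous semigroup generated by $\overline{\mathcal{QL}}\mathcal Q$; in particular $\eta_0=\mathcal{QL}z$, and the solution $(K,\eta)$ is unique. Moreover, $\eta$ is the unique mild solution of the abstract Cauchy problem $\frac{d}{dt}u=\overline{\mathcal{QL}}\mathcal Q\,u$, $u(0)=\eta_0$: the map $t\mapsto\eta_t$ is continuous on $[0,\infty)$, and for all $t\ge 0$ one has $\int_0^t\eta_s\,ds\in D(\overline{\mathcal{QL}}\mathcal Q)$ and $$\eta_t=\eta_0+\overline{\mathcal{QL}}\mathcal Q\int_0^t\eta_s\,ds ,$$ and every continuous $v\colon[0,\infty)\to H$ with $v_0=\eta_0$, $\int_0^t v_s\,ds\in D(\overline{\mathcal{QL}}\mathcal Q)$ and $v_t=\eta_0+\overline{\mathcal{QL}}\mathcal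 Q\int_0^t v_s\,ds$ for all $t\ge0$ is equal to $\eta$. -/

import Mathlib

open Filter Topology MeasureTheory Set
open scoped LinearPMap

noncomputable section

namespace MoriGLE

variable {H : Type*} [NormedAddCommGroup H] [InnerProductSpace ℂ H]

/-- `U` (restricted to times `t ≥ 0`) is a strongly continuous one-parameter semigroup of bounded
linear operators on `H`. The values `U t` for `t < 0` play no role. -/
structure IsC0Semigroup (U : ℝ → H →L[ℂ] H) : Prop where
  map_zero : U 0 = 1
  map_add : ∀ s t : ℝ, 0 ≤ s → 0 ≤ t → U (s + t) = (U s).comp (U t)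
  continuousOn_orbit : ∀ x : H, ContinuousOn (fun t : ℝ => U t x) (Ici 0)

/-- `y` is the limit of the difference quotients `h⁻¹ (U(h) x - x)` as `h ↘ 0`. -/
def HasGenerator (U : ℝ → H →L[ℂ] H) (x y : H) : Prop :=
  Tendsto (fun h : ℝ => h⁻¹ • (U h x - x)) (𝓝[>] (0 : ℝ)) (𝓝 y)

theorem HasGenerator.unique {U : ℝ → H →L[ℂ] H} {x y y' : H}
    (h : HasGenerator U x y) (h' : HasGenerator U x y') : y = y' :=
  tendsto_nhds_unique h h'

theorem HasGenerator.add {U : ℝ → H →L[ℂ] H} {x y x' y' : H}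
    (h : HasGenerator U x y) (h' : HasGenerator U x' y') :
    HasGenerator U (x + x') (y + y') := by
  refine (Tendsto.add h h').congr fun r => ?_
  rw [← smul_add, (U r).map_add]
  congr 1
  abel

theorem HasGenerator.smul {U : ℝ → H →L[ℂ] H} {x y : H} (c : ℂ)
    (h : HasGenerator U x y) : HasGenerator U (c • x) (c • y) := by
  refine (Tendsto.const_smul h c).congr fun r => ?_
  rw [(U r).map_smul, ← smul_sub, smul_comm]

theorem HasGenerator.zero (U : ℝ → H →L[ℂ] H) : HasGenerator U 0 0 := by
  simp [HasGenerator]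

/-- The generator `L` of `U`: `L x = lim_{h ↘ 0} h⁻¹ (U(h) x - x)`, on the domain of all `x` for
which this limit exists in `H`. -/
def generator (U : ℝ → H →L[ℂ] H) : H →ₗ.[ℂ] H where
  domain :=
    { carrier := {x | ∃ y, HasGenerator U x y}
      zero_mem' := ⟨0, HasGenerator.zero U⟩
      add_mem' := fun ⟨y, hy⟩ ⟨y', hy'⟩ => ⟨y + y', hy.add hy'⟩
      smul_mem' := fun c _ ⟨y, hy⟩ => ⟨c • y, hy.smul c⟩ }
  toFun :=
    { toFun := fun x => x.2.choose
      map_add' := fun x x' =>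
        (x + x').2.choose_spec.unique (x.2.choose_spec.add x'.2.choose_spec)
      map_smul' := fun c x =>
        (c • x).2.choose_spec.unique (x.2.choose_spec.smul c) }

theorem generator_spec (U : ℝ → H →L[ℂ] H) (x : (generator U).domain) :
    HasGenerator U x (generator U x) :=
  x.2.choose_spec

/-- The Mori projection `P x = (x, z) (z, z)⁻¹ z`. Mathlib's inner product is conjugate-linear in
its first argument, so that `(x, z)`, linear in `x`, is `inner ℂ z x`. -/
def moriP (z : H) : H →L[ℂ] H :=
  (inner ℂ z z)⁻¹ • (innerSL ℂ z).smulRight z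

theorem moriP_apply (z x : H) :
    moriP z x = (inner ℂ z x * (inner ℂ z z)⁻¹) • z := by
  simp [moriP, smul_smul, mul_comm]

/-- The complementary projection `Q = 1 - P`. -/
def moriQ (z : H) : H →L[ℂ] H := 1 - moriP z

/-- The product `A B` of a partially defined operator `A` with an everywhere defined bounded
operator `B`, on the domain `{x | B x ∈ D(A)}`. -/
def mulRight (A : H →ₗ.[ℂ] H) (B : H →L[ℂ] H) : H →ₗ.[ℂ] H where
  domain := A.domain.comap B.toLinearMap
  toFun :=
    { toFun := fun x => A ⟨B x, x.2⟩
      map_add' := fun x y => by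
        rw [← A.map_add]; congr 1; ext; simp
      map_smul' := fun c x => by
        rw [RingHom.id_apply, ← A.map_smul]; congr 1; ext; simp }

/-- The operator `QL` with domain `D(L)`, where `L` is the generator of `U`. -/
def opQL (U : ℝ → H →L[ℂ] H) (z : H) : H →ₗ.[ℂ] H :=
  (moriQ z).toLinearMap.compPMap (generator U)

/-- The operator `closure(QL) Q`, with domain `{x | Q x ∈ D(closure(QL))}`. -/
def opOrth (U : ℝ → H →L[ℂ] H) (z : H) : H →ₗ.[ℂ] H :=
  mulRight (opQL U z).closure (moriQ z)

/-- `(K, η)`, restricted to times `t ≥ 0`, solves the system consisting of the generalized Langevin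
equation `d/dt U(t)z = U(t)PLz + η_t + ∫₀ᵗ K(t-s) U(s)z ds` and the fluctuation dissipation relation
`K(t) = (η_t, QL†z) (z,z)⁻¹`, for all `t ≥ 0`. The derivative at `t = 0` is the right
derivative. Local integrability of `K` says that the memory integrals exist. -/
structure IsGLESolution [CompleteSpace H] (U : ℝ → H →L[ℂ] H) (z : H)
    (hz : z ∈ (generator U).domain) (hz' : z ∈ (generator U)†.domain)
    (K : ℝ → ℂ) (η : ℝ → H) : Prop where
  integrable : ∀ t : ℝ, 0 ≤ t → IntervalIntegrable K volume 0 t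
  gle : ∀ t : ℝ, 0 ≤ t →
    HasDerivWithinAt (fun r : ℝ => U r z)
      (U t (moriP z (generator U ⟨z, hz⟩)) + η t + ∫ s in (0 : ℝ)..t, K (t - s) • U s z)
      (Ici 0) t
  fdt : ∀ t : ℝ, 0 ≤ t →
    K t = inner ℂ (moriQ z ((generator U)† ⟨z, hz'⟩)) (η t) * (inner ℂ z z)⁻¹

/-- `u`, restricted to times `t ≥ 0`, is a mild solution of the abstract Cauchy problem
`u' = A u`, `u(0) = x`: it is continuous, `u(0) = x`, and for all `t ≥ 0` the integral `∫₀ᵗ u(s) ds`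
lies in `D(A)` and `u(t) = x + A ∫₀ᵗ u(s) ds`. -/
structure IsMildSolution (A : H →ₗ.[ℂ] H) (x : H) (u : ℝ → H) : Prop where
  continuousOn : ContinuousOn u (Ici 0)
  initial : u 0 = x
  eq_integral : ∀ t : ℝ, 0 ≤ t →
    ∃ h : (∫ s in (0 : ℝ)..t, u s) ∈ A.domain, u t = x + A ⟨∫ s in (0 : ℝ)..t, u s, h⟩

end MoriGLE

end

/-!
With `L` the generator of `U`, the operator `P L` extends to the bounded operator
`B x = (x, L†z) (z, z)⁻¹ z`, because `z` lies in the domain of `L†`. Hence `Q L = L - B` on `D(L)`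
is already closed (`isClosed_opQL`). Since `P` maps into `D(L)`, the operator `closure(QL) Q` is
again defined on `D(L)` and equals `L + C` with `C` bounded of rank at most two
(`mem_graph_opOrth`). The bounded perturbation theorem (`exists_perturbation`), proved by solving
a Volterra equation in a weighted space of continuous functions, gives the semigroup `G` together
with `G(t) w = U(t) w + ∫₀ᵗ U(t - s) C G(s) w ds`.

For `w = Q L z` the orbit `G(s) w` stays orthogonal to `z`, where `C x = - (x, Q L†z) (z, z)⁻¹ z`.
The variation of constants formula then reads `U(t) w = G(t) w + ∫₀ᵗ K(s) U(t - s) z ds` with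
`K(s) = (G(s) w, Q L†z) (z, z)⁻¹`, and adding `U(t) P L z` yields the generalized Langevin
equation for `η = G(·) w`. Its solution is unique (`IsGLESolution.eq`): the difference of two
solutions satisfies a homogeneous Volterra inequality, which forces a locally integrable memory
kernel to vanish. Finally, orbits of a semigroup are the unique mild solutions for its generator
(`eq_of_isMildSolution`), which also shows that `G` is determined by its generator for `t ≥ 0`.
-/

namespace MoriGLE

variable {H : Type*} [NormedAddCommGroup H] [InnerProductSpace ℂ H]

/-! ### Strongly continuous semigroups -/

theorem hasDerivWithinAt_Ici_iff_tendsto {E : Type*} [NormedAddCommGroup E] [NormedSpace ℝ E]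
    {f : ℝ → E} {f' : E} {x : ℝ} :
    HasDerivWithinAt f f' (Ici x) x ↔
      Tendsto (fun h : ℝ => h⁻¹ • (f (x + h) - f x)) (𝓝[>] 0) (𝓝 f') := by
  have hmap : map (fun h : ℝ => x + h) (𝓝[>] 0) = 𝓝[>] x := by
    simp
  rw [← hasDerivWithinAt_Ioi_iff_Ici, hasDerivWithinAt_iff_tendsto_slope' (by simp), ← hmap,
    tendsto_map'_iff]
  refine tendsto_congr fun h => ?_
  simp [slope_def_module]

theorem IsMildSolution.congr {A : H →ₗ.[ℂ] H} {x : H} {u v : ℝ → H} (hu : IsMildSolution A x u)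
    (h : ∀ t : ℝ, 0 ≤ t → v t = u t) : IsMildSolution A x v where
  continuousOn := hu.continuousOn.congr fun t ht => h t ht
  initial := (h 0 le_rfl).trans hu.initial
  eq_integral t ht := by
    have hI : ∫ s in (0 : ℝ)..t, v s = ∫ s in (0 : ℝ)..t, u s :=
      intervalIntegral.integral_congr fun s hs => by
        rw [uIcc_of_le ht] at hs; exact h s hs.1
    rw [h t ht, hI]
    exact hu.eq_integral t ht

namespace IsC0Semigroup

variable {U : ℝ → H →L[ℂ] H}

/-- Replacing the time `t` by `max t 0` makes orbits continuous on all of `ℝ`. -/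
theorem continuous_orbit_max (hU : IsC0Semigroup U) (x : H) :
    Continuous fun t : ℝ => U (max t 0) x :=
  (hU.continuousOn_orbit x).comp_continuous (by fun_prop) fun _ => mem_Ici.2 (le_max_right _ _)

theorem integral_orbit_max (x : H) {t : ℝ} (ht : 0 ≤ t) :
    ∫ s in (0 : ℝ)..t, U (max s 0) x = ∫ s in (0 : ℝ)..t, U s x := by
  refine intervalIntegral.integral_congr fun s hs => ?_
  rw [uIcc_of_le ht] at hs
  simp [max_eq_left hs.1]

theorem intervalIntegrable_orbit (hU : IsC0Semigroup U) (x : H) {t : ℝ} (ht : 0 ≤ t) :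
    IntervalIntegrable (fun s => U s x) volume 0 t :=
  ((hU.continuousOn_orbit x).mono fun s hs => by
    rw [uIcc_of_le ht] at hs; exact hs.1).intervalIntegrable

theorem map_add_apply (hU : IsC0Semigroup U) {s t : ℝ} (hs : 0 ≤ s) (ht : 0 ≤ t) (x : H) :
    U (s + t) x = U s (U t x) := by
  rw [hU.map_add s t hs ht]; rfl

theorem hasDerivWithinAt_orbit_Ici (hU : IsC0Semigroup U) {x y : H} (h : HasGenerator U x y)
    {t : ℝ} (ht : 0 ≤ t) : HasDerivWithinAt (fun s => U s x) (U t y) (Ici t) t := by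
  rw [hasDerivWithinAt_Ici_iff_tendsto]
  refine (((U t).continuous.tendsto y).comp h).congr' ?_
  filter_upwards [self_mem_nhdsWithin] with r hr
  have hr : 0 < r := hr
  rw [hU.map_add_apply ht hr.le, ← map_sub]
  exact (U t).map_smul_of_tower r⁻¹ _

variable [CompleteSpace H]

theorem exists_norm_le (hU : IsC0Semigroup U) (T : ℝ) :
    ∃ M : ℝ, 1 ≤ M ∧ ∀ t ∈ Icc (0 : ℝ) T, ‖U t‖ ≤ M := by
  obtain ⟨M, hM⟩ := banach_steinhaus (g := fun t : Icc (0 : ℝ) T => U t) fun x => by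
    obtain ⟨B, hB⟩ := (isCompact_Icc (a := (0 : ℝ)) (b := T)).exists_bound_of_continuousOn
      ((hU.continuousOn_orbit x).mono fun t ht => ht.1)
    exact ⟨B, fun t => hB t t.2⟩
  exact ⟨max M 1, le_max_right _ _, fun t ht => (hM ⟨t, ht⟩).trans (le_max_left _ _)⟩

/-- Joint strong continuity, from the local bound on the operator norms. -/
theorem tendsto_apply (hU : IsC0Semigroup U) {α : Type*} {l : Filter α} {τ : α → ℝ} {y : α → H}
    {t₀ : ℝ} {y₀ : H} (ht₀ : 0 ≤ t₀) (hτ : Tendsto τ l (𝓝 t₀)) (hτ0 : ∀ᶠ a in l, 0 ≤ τ a)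
    (hy : Tendsto y l (𝓝 y₀)) : Tendsto (fun a => U (τ a) (y a)) l (𝓝 (U t₀ y₀)) := by
  obtain ⟨M, -, hM⟩ := hU.exists_norm_le (t₀ + 1)
  have h1 : Tendsto (fun a => U (τ a) y₀) l (𝓝 (U t₀ y₀)) :=
    (hU.continuousOn_orbit y₀ t₀ ht₀).tendsto.comp (tendsto_nhdsWithin_iff.2 ⟨hτ, hτ0⟩)
  have h2 : Tendsto (fun a => U (τ a) (y a - y₀)) l (𝓝 0) := by
    have h3 : Tendsto (fun a => M * ‖y a - y₀‖) l (𝓝 0) := by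
      simpa using (tendsto_iff_norm_sub_tendsto_zero.1 hy).const_mul M
    refine squeeze_zero_norm' ?_ h3
    filter_upwards [hτ0, hτ.eventually (gt_mem_nhds (lt_add_one t₀))] with a h0 h1
    exact (U (τ a)).le_of_opNorm_le (hM _ ⟨h0, h1.le⟩) _
  simpa using h2.add h1

theorem continuous_apply_max (hU : IsC0Semigroup U) {X : Type*} [TopologicalSpace X] {τ : X → ℝ}
    {y : X → H} (hτ : Continuous τ) (hy : Continuous y) :
    Continuous fun a => U (max (τ a) 0) (y a) :=
  continuous_iff_continuousAt.2 fun a =>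
    hU.tendsto_apply (le_max_right _ _)
      (by exact (hτ.max continuous_const).continuousAt.tendsto)
      (Eventually.of_forall fun _ => le_max_right _ _) hy.continuousAt.tendsto

theorem exists_norm_le_exp (hU : IsC0Semigroup U) :
    ∃ M ω : ℝ, 1 ≤ M ∧ ∀ t : ℝ, 0 ≤ t → ‖U t‖ ≤ M * Real.exp (ω * t) := by
  obtain ⟨M, hM1, hM⟩ := hU.exists_norm_le 1
  have hM0 : 0 < M := by linarith
  have key : ∀ n : ℕ, ∀ t : ℝ, 0 ≤ t → t ≤ n + 1 → ‖U t‖ ≤ M ^ (n + 1) := by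
    intro n
    induction n with
    | zero => intro t h0 h1; simpa using hM t ⟨h0, by simpa using h1⟩
    | succ n ih =>
      intro t h0 h1
      push_cast at h1
      rcases le_total t 1 with h | h
      · exact (hM t ⟨h0, h⟩).trans (le_self_pow₀ hM1 (by omega))
      · have : U t = (U 1).comp (U (t - 1)) := by
          rw [← hU.map_add 1 (t - 1) zero_le_one (by linarith)]; congr 1; ring
        rw [this, pow_succ']
        exact (ContinuousLinearMap.opNorm_comp_le _ _).trans
          (mul_le_mul (hM 1 ⟨zero_le_one, le_rfl⟩) (ih _ (by linarith) (by linarith))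
            (norm_nonneg _) hM0.le)
  refine ⟨M, Real.log M, hM1, fun t ht => ?_⟩
  refine (key ⌊t⌋₊ t ht (Nat.lt_floor_add_one t).le).trans ?_
  rw [pow_succ']
  refine mul_le_mul_of_nonneg_left ?_ hM0.le
  rw [← Real.rpow_natCast, Real.rpow_def_of_pos hM0]
  exact Real.exp_le_exp.2 (mul_le_mul_of_nonneg_left (Nat.floor_le ht) (Real.log_nonneg hM1))

theorem hasGenerator_integral (hU : IsC0Semigroup U) (x : H) {t : ℝ} (ht : 0 ≤ t) :
    HasGenerator U (∫ s in (0 : ℝ)..t, U s x) (U t x - x) := by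
  have hc := hU.continuous_orbit_max x
  have hd := fun r => (hc.integral_hasStrictDerivAt 0 r).hasDerivAt.tendsto_slope_zero_right
  have h := (hd t).sub (hd 0)
  simp only [max_eq_left ht, max_self, hU.map_zero, one_apply_eq_self] at h
  refine h.congr' ?_
  filter_upwards [self_mem_nhdsWithin] with r hr
  have hr : 0 < r := hr
  rw [← smul_sub]
  congr 1
  have hint : ∀ a b : ℝ, IntervalIntegrable (fun s => U (max s 0) x) volume a b :=
    fun a b => hc.intervalIntegrable a b
  have hUr : U r (∫ s in (0 : ℝ)..t, U s x) = ∫ s in r..(r + t), U (max s 0) x := by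
    rw [← ContinuousLinearMap.intervalIntegral_comp_comm _ (hU.intervalIntegrable_orbit x ht)]
    have h1 := intervalIntegral.integral_comp_add_left (a := 0) (b := t)
      (fun s => U (max s 0) x) r
    rw [add_zero] at h1
    rw [← h1]
    refine intervalIntegral.integral_congr fun s hs => ?_
    rw [uIcc_of_le ht] at hs
    rw [max_eq_left (by linarith [hs.1]), hU.map_add_apply hr.le hs.1]
  rw [← integral_orbit_max (U := U) x ht] at hUr ⊢
  rw [hUr, intervalIntegral.integral_same, sub_zero, zero_add, add_comm t r, sub_right_comm,
    intervalIntegral.integral_interval_sub_left (hint _ _) (hint _ _)]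

theorem apply_eq_add_integral (hU : IsC0Semigroup U) {x y : H} (h : HasGenerator U x y)
    {t : ℝ} (ht : 0 ≤ t) : U t x = x + ∫ s in (0 : ℝ)..t, U s y := by
  have hc := hU.continuous_orbit_max y
  have hd := fun r => (hc.integral_hasStrictDerivAt 0 r).hasDerivAt
  have h0 := constant_of_has_deriv_right_zero (a := 0) (b := t)
    (f := fun r => U r x - ∫ s in (0 : ℝ)..r, U (max s 0) y)
    (((hU.continuousOn_orbit x).mono fun s hs => hs.1).sub fun r _ =>
      (hd r).continuousAt.continuousWithinAt)
    (fun r hr => by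
      have h1 := (hU.hasDerivWithinAt_orbit_Ici h hr.1).sub (hd r).hasDerivWithinAt
      rw [max_eq_left hr.1, sub_self] at h1
      exact h1) t ⟨ht, le_rfl⟩
  simp only [intervalIntegral.integral_same, hU.map_zero, sub_zero,
    one_apply_eq_self] at h0
  rw [← integral_orbit_max y ht]
  exact sub_eq_iff_eq_add.1 h0

theorem hasDerivWithinAt_orbit (hU : IsC0Semigroup U) {x y : H} (h : HasGenerator U x y)
    {t : ℝ} (ht : 0 ≤ t) : HasDerivWithinAt (fun s => U s x) (U t y) (Ici 0) t := by
  have hd := ((hU.continuous_orbit_max y).integral_hasStrictDerivAt 0 t).hasDerivAt.const_add x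
  rw [max_eq_left ht] at hd
  refine hd.hasDerivWithinAt.congr (fun s hs => ?_) ?_
  · rw [hU.apply_eq_add_integral h hs, integral_orbit_max y hs]
  · rw [hU.apply_eq_add_integral h ht, integral_orbit_max y ht]

/-- The graph of the generator in terms of an equation that is closed in `(x, y)`. -/
theorem hasGenerator_iff (hU : IsC0Semigroup U) {x y : H} :
    HasGenerator U x y ↔ ∀ t : ℝ, 0 ≤ t → U t x = x + ∫ s in (0 : ℝ)..t, U s y := by
  refine ⟨fun h t ht => hU.apply_eq_add_integral h ht, fun h => ?_⟩
  have hd := ((hU.continuous_orbit_max y).integral_hasStrictDerivAt 0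
    0).hasDerivAt.tendsto_slope_zero_right
  simp only [max_self, hU.map_zero, one_apply_eq_self,
    intervalIntegral.integral_same, zero_add, sub_zero] at hd
  refine hd.congr' ?_
  filter_upwards [self_mem_nhdsWithin] with r hr
  have hr : 0 < r := hr
  rw [h r hr.le, integral_orbit_max y hr.le, add_sub_cancel_left]

end IsC0Semigroup

theorem HasGenerator.mem_domain {U : ℝ → H →L[ℂ] H} {x y : H} (h : HasGenerator U x y) :
    x ∈ (generator U).domain :=
  ⟨y, h⟩

theorem generator_eq_of_hasGenerator {U : ℝ → H →L[ℂ] H} {x y : H} (h : HasGenerator U x y)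
    (hx : x ∈ (generator U).domain) : generator U ⟨x, hx⟩ = y :=
  (generator_spec U ⟨x, hx⟩).unique h

theorem mem_graph_generator {U : ℝ → H →L[ℂ] H} {p : H × H} :
    p ∈ (generator U).graph ↔ HasGenerator U p.1 p.2 := by
  rw [LinearPMap.mem_graph_iff]
  constructor
  · rintro ⟨x, h1, h2⟩
    rw [← h1, ← h2]
    exact generator_spec U x
  · intro h
    exact ⟨⟨p.1, h.mem_domain⟩, rfl, generator_eq_of_hasGenerator h _⟩

namespace IsC0Semigroup

variable {U : ℝ → H →L[ℂ] H} [CompleteSpace H]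

theorem isClosed_generator (hU : IsC0Semigroup U) : (generator U).IsClosed := by
  have hset : ((generator U).graph : Set (H × H)) =
      ⋂ t : Ici (0 : ℝ), {p | U t p.1 = p.1 + ∫ s in (0 : ℝ)..t, U (max s 0) p.2} := by
    ext p
    simp only [SetLike.mem_coe, mem_graph_generator, hU.hasGenerator_iff, mem_iInter,
      mem_ofPred_eq, Subtype.forall, mem_Ici]
    exact forall₂_congr fun t ht => by rw [integral_orbit_max _ ht]
  rw [LinearPMap.IsClosed, hset]
  refine isClosed_iInter fun t => isClosed_eq (by fun_prop) ?_
  exact continuous_fst.add (intervalIntegral.continuous_parametric_intervalIntegral_of_continuous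
    (f := fun (p : H × H) s => U (max s 0) p.2)
    (hU.continuous_apply_max (by fun_prop) (by fun_prop)) continuous_const)

theorem dense_domain_generator (hU : IsC0Semigroup U) :
    Dense ((generator U).domain : Set H) := by
  intro x
  have hd := ((hU.continuous_orbit_max x).integral_hasStrictDerivAt 0
    0).hasDerivAt.tendsto_slope_zero_right
  simp only [max_self, hU.map_zero, one_apply_eq_self,
    intervalIntegral.integral_same, zero_add, sub_zero] at hd
  refine mem_closure_of_tendsto hd ?_
  filter_upwards [self_mem_nhdsWithin] with r hr
  have hr : 0 < r := hr
  rw [integral_orbit_max x hr.le]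
  exact (generator U).domain.smul_of_tower_mem r⁻¹
    (hU.hasGenerator_integral x hr.le).mem_domain

theorem isMildSolution (hU : IsC0Semigroup U) (x : H) :
    IsMildSolution (generator U) x fun t => U t x where
  continuousOn := hU.continuousOn_orbit x
  initial := by simp [hU.map_zero]
  eq_integral t ht := by
    have h := hU.hasGenerator_integral x ht
    exact ⟨h.mem_domain, by rw [generator_eq_of_hasGenerator h]; abel⟩

/-- Mild solutions are unique. If `w` is the difference of two of them and `W` its primitive, then
`W' = A W`, and `s ↦ U (t - s) W(s)` has vanishing right derivative: the difference quotient is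
`U (t - s - h)` applied to `h⁻¹ (W(s + h) - W(s)) - h⁻¹ (U(h) W(s) - W(s))`, so that only the right
derivatives of `W` and of an orbit enter. -/
theorem eq_of_isMildSolution (hU : IsC0Semigroup U) {x : H} {v : ℝ → H}
    (hv : IsMildSolution (generator U) x v) {t : ℝ} (ht : 0 ≤ t) : v t = U t x := by
  set w : ℝ → H := fun s => v (max s 0) - U (max s 0) x with hw_def
  have hw : Continuous w :=
    (hv.continuousOn.comp_continuous (by fun_prop) fun _ => mem_Ici.2 (le_max_right _ _)).sub
      (hU.continuous_orbit_max x)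
  set W : ℝ → H := fun s => ∫ r in (0 : ℝ)..s, w r with hW_def
  have hdW : ∀ s, HasDerivAt W (w s) s := fun s => (hw.integral_hasStrictDerivAt 0 s).hasDerivAt
  have hgen : ∀ s, 0 ≤ s → HasGenerator U (W s) (w s) := by
    intro s hs
    obtain ⟨h, hvs⟩ := hv.eq_integral s hs
    have hWs : W s = (∫ r in (0 : ℝ)..s, v r) + (-1 : ℂ) • ∫ r in (0 : ℝ)..s, U r x := by
      rw [neg_one_smul, ← sub_eq_add_neg, ← intervalIntegral.integral_sub
        ((hv.continuousOn.mono fun r hr => by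
          rw [uIcc_of_le hs] at hr; exact hr.1).intervalIntegrable)
        (hU.intervalIntegrable_orbit x hs)]
      refine intervalIntegral.integral_congr fun r hr => ?_
      rw [uIcc_of_le hs] at hr
      simp [hw_def, max_eq_left hr.1]
    have hws : w s = generator U ⟨_, h⟩ + (-1 : ℂ) • (U s x - x) := by
      simp only [hw_def, max_eq_left hs]
      rw [hvs, neg_one_smul]
      abel
    rw [hWs, hws]
    exact (generator_spec U ⟨_, h⟩).add ((hU.hasGenerator_integral x hs).smul _)
  have hzero : ∀ t, 0 ≤ t → W t = 0 := by
    intro t ht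
    have h0 := constant_of_has_deriv_right_zero (a := 0) (b := t)
      (f := fun s => U (max (t - s) 0) (W s))
      (hU.continuous_apply_max (by fun_prop)
        (continuous_iff_continuousAt.2 fun s => (hdW s).continuousAt)).continuousOn
      (fun s hs => by
        rw [hasDerivWithinAt_Ici_iff_tendsto]
        have h1 : Tendsto (fun h : ℝ => h⁻¹ • (W (s + h) - W s) - h⁻¹ • (U h (W s) - W s))
            (𝓝[>] 0) (𝓝 0) := by
          simpa using (hdW s).tendsto_slope_zero_right.sub (hgen s hs.1)
        have h2 : Tendsto (fun h : ℝ => t - s - h) (𝓝[>] 0) (𝓝 (t - s)) := by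
          have : ContinuousAt (fun h : ℝ => t - s - h) 0 := by fun_prop
          simpa using this.tendsto.mono_left nhdsWithin_le_nhds
        have hlt : ∀ᶠ h : ℝ in 𝓝[>] 0, 0 ≤ t - s - h :=
          (h2.eventually (lt_mem_nhds (sub_pos.2 hs.2))).mono fun h hh => hh.le
        have h3 := hU.tendsto_apply (sub_nonneg.2 hs.2.le) h2 hlt h1
        rw [_root_.map_zero] at h3
        refine h3.congr' ?_
        filter_upwards [hlt, self_mem_nhdsWithin] with h hh hpos
        have hpos : 0 < h := hpos
        have hts : t - s = t - s - h + h := by ring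
        rw [max_eq_left (by linarith), max_eq_left (by linarith [hs.2]), hts,
          hU.map_add_apply hh hpos.le, ← hts, ← smul_sub, sub_sub_sub_cancel_right,
          ← sub_sub, ← map_sub]
        exact (U (t - s - h)).map_smul_of_tower h⁻¹ _) t ⟨ht, le_rfl⟩
    have hW0 : W 0 = 0 := intervalIntegral.integral_same
    simpa only [sub_self, max_self, hU.map_zero, one_apply_eq_self, hW0, _root_.map_zero] using h0
  have hwt : w t = 0 := by
    refine (uniqueDiffOn_Ici (0 : ℝ) t ht).eq_deriv _ (hdW t).hasDerivWithinAt ?_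
    exact (hasDerivWithinAt_const t (Ici 0) (0 : H)).congr (fun s hs => hzero s hs) (hzero t ht)
  simpa [hw_def, max_eq_left ht, sub_eq_zero] using hwt

end IsC0Semigroup

/-! ### Bounded perturbations -/

/-- Grönwall's inequality in integral form, for a function that is only assumed integrable:
iterating the inequality gives `φ t ≤ B (M t) ^ n / n!` for all `n`. -/
theorem eq_zero_of_le_mul_integral {φ : ℝ → ℝ} {M T : ℝ} (hM : 0 ≤ M)
    (hφ0 : ∀ t ∈ Icc 0 T, 0 ≤ φ t) (hint : IntervalIntegrable φ volume 0 T)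
    (h : ∀ t ∈ Icc 0 T, φ t ≤ M * ∫ s in (0 : ℝ)..t, φ s) {t : ℝ} (ht : t ∈ Icc 0 T) :
    φ t = 0 := by
  have hT : 0 ≤ T := ht.1.trans ht.2
  have hintt : ∀ t ∈ Icc 0 T, IntervalIntegrable φ volume 0 t := fun t ht =>
    hint.mono_set (by rw [uIcc_of_le ht.1, uIcc_of_le hT]; exact Icc_subset_Icc_right ht.2)
  set B := M * ∫ s in (0 : ℝ)..T, φ s with hB
  have key : ∀ n : ℕ, ∀ t ∈ Icc 0 T, φ t ≤ B * ((M * t) ^ n / n.factorial) := by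
    intro n
    induction n with
    | zero =>
      intro t ht
      have : ∫ s in (0 : ℝ)..t, φ s ≤ ∫ s in (0 : ℝ)..T, φ s := by
        refine intervalIntegral.integral_mono_interval le_rfl ht.1 ht.2 ?_ hint
        exact (ae_restrict_iff' measurableSet_Ioc).2
          (Eventually.of_forall fun s hs => hφ0 s ⟨hs.1.le, hs.2⟩)
      simpa using (h t ht).trans (mul_le_mul_of_nonneg_left this hM)
    | succ n ih =>
      intro t ht
      refine (h t ht).trans ?_
      have h1 : ∫ s in (0 : ℝ)..t, φ s ≤
          ∫ s in (0 : ℝ)..t, B * ((M * s) ^ n / n.factorial) :=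
        intervalIntegral.integral_mono_on ht.1 (hintt t ht)
          (Continuous.intervalIntegrable (by fun_prop) _ _)
          fun s hs => ih s ⟨hs.1, hs.2.trans ht.2⟩
      refine (mul_le_mul_of_nonneg_left h1 hM).trans (le_of_eq ?_)
      have h2 : ∀ s : ℝ, B * ((M * s) ^ n / n.factorial) = B * M ^ n / n.factorial * s ^ n := by
        intro s; rw [mul_pow]; ring
      simp_rw [h2]
      rw [intervalIntegral.integral_const_mul, integral_pow, Nat.factorial_succ]
      push_cast
      field_simp
      ring
  have hlim : Tendsto (fun n : ℕ => B * ((M * t) ^ n / n.factorial)) atTop (𝓝 0) := by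
    simpa using (FloorSemiring.tendsto_pow_div_factorial_atTop (M * t)).const_mul B
  exact le_antisymm (ge_of_tendsto' hlim fun n => key n t ht) (hφ0 t ht)

namespace IsC0Semigroup

variable {U : ℝ → H →L[ℂ] H} [CompleteSpace H]

theorem eq_zero_of_eq_integral (hU : IsC0Semigroup U) (C : H →L[ℂ] H) {D : ℝ → H}
    (hD : ContinuousOn D (Ici 0))
    (h : ∀ t : ℝ, 0 ≤ t → D t = ∫ s in (0 : ℝ)..t, U (t - s) (C (D s))) {t : ℝ} (ht : 0 ≤ t) :
    D t = 0 := by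
  obtain ⟨M, hM1, hM⟩ := hU.exists_norm_le t
  have hint : ∀ r, 0 ≤ r → IntervalIntegrable (fun s => ‖D s‖) volume 0 r := fun r hr =>
    (hD.norm.mono fun s hs => by rw [uIcc_of_le hr] at hs; exact hs.1).intervalIntegrable
  refine norm_eq_zero.1 (eq_zero_of_le_mul_integral (φ := fun s => ‖D s‖) (M := M * ‖C‖) (T := t)
    (by positivity) (fun _ _ => norm_nonneg _) (hint t ht) (fun r hr => ?_) ⟨ht, le_rfl⟩)
  rw [h r hr.1, ← intervalIntegral.integral_const_mul]
  refine intervalIntegral.norm_integral_le_of_norm_le hr.1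
    (Eventually.of_forall fun s hs => ?_) ((hint r hr.1).const_mul _)
  rw [mul_assoc]
  exact (U (r - s)).le_of_opNorm_le_of_le (hM _ ⟨by linarith [hs.2], by linarith [hs.1, hr.2]⟩)
    (C.le_opNorm _)

/-- The Volterra equation `G(t) x = U(t) x + ∫₀ᵗ U(t - s) C G(s) x ds` has a solution consisting of
bounded operators. After multiplication by `exp (-ℓ t)` it reads `u = ι x + V u` in the space of
bounded continuous functions, and for large `ℓ` the operator `V` has norm `< 1`, so that
`u = (1 - V)⁻¹ ι x`, which is linear and bounded in `x`. -/
theorem exists_volterra (hU : IsC0Semigroup U) (C : H →L[ℂ] H) :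
    ∃ G : ℝ → H →L[ℂ] H, (∀ x, ContinuousOn (fun t => G t x) (Ici 0)) ∧
      ∀ x, ∀ t : ℝ, 0 ≤ t → G t x = U t x + ∫ s in (0 : ℝ)..t, U (t - s) (C (G s x)) := by
  obtain ⟨M, ω, hM1, hM⟩ := hU.exists_norm_le_exp
  have hM0 : 0 < M := by linarith
  -- with this `μ`, the bound `M ‖C‖ / μ` for the norm of `V` is less than one
  set μ : ℝ := M * ‖C‖ + 1 with hμ
  have hμ0 : 0 < μ := by positivity
  set ℓ : ℝ := ω + μ with hℓ
  set W : ℝ → H →L[ℂ] H := fun t => Real.exp (-ℓ * max t 0) • U (max t 0) with hW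
  have hWc : ∀ {X : Type _} [TopologicalSpace X] {τ : X → ℝ} {y : X → H}, Continuous τ →
      Continuous y → Continuous fun a => W (τ a) (y a) := by
    intro X _ τ y hτ hy
    have := hU.continuous_apply_max hτ hy
    exact (Continuous.rexp (by fun_prop)).smul this
  have hWn : ∀ t, 0 ≤ t → ‖W t‖ ≤ M * Real.exp (-μ * t) := by
    intro t ht
    simp only [hW, max_eq_left ht]
    rw [norm_smul, Real.norm_of_nonneg (Real.exp_pos _).le]
    refine (mul_le_mul_of_nonneg_left (hM t ht) (Real.exp_pos _).le).trans (le_of_eq ?_)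
    rw [mul_left_comm, ← Real.exp_add, hℓ]
    congr 2
    ring
  have hexp : ∀ τ, 0 ≤ τ → ∫ s in (0 : ℝ)..τ, Real.exp (-μ * (τ - s)) ≤ 1 / μ := by
    intro τ hτ
    rw [intervalIntegral.integral_comp_sub_left (fun s => Real.exp (-μ * s)) τ, sub_self, sub_zero,
      intervalIntegral.integral_comp_mul_left (fun s => Real.exp s) (neg_ne_zero.2 hμ0.ne'),
      integral_exp, mul_zero, Real.exp_zero, smul_eq_mul, one_div, ← neg_sub, mul_neg, ← neg_mul,
      ← inv_neg, neg_neg]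
    exact mul_le_of_le_one_right (inv_nonneg.2 hμ0.le) (by linarith [Real.exp_pos (-μ * τ)])
  have hVc : ∀ v : BoundedContinuousFunction ℝ H, Continuous fun t : ℝ =>
      ∫ s in (0 : ℝ)..max t 0, W (max t 0 - s) (C (v s)) := fun v =>
    intervalIntegral.continuous_parametric_intervalIntegral_of_continuous
      (f := fun t s => W (max t 0 - s) (C (v s)))
      (hWc (X := ℝ × ℝ) (by fun_prop) (by fun_prop)) (by fun_prop)
  have hVn : ∀ v : BoundedContinuousFunction ℝ H, ∀ t : ℝ,
      ‖∫ s in (0 : ℝ)..max t 0, W (max t 0 - s) (C (v s))‖ ≤ M * ‖C‖ / μ * ‖v‖ := by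
    intro v t
    have hτ : 0 ≤ max t 0 := le_max_right _ _
    generalize max t 0 = τ at hτ
    refine (intervalIntegral.norm_integral_le_of_norm_le hτ
      (g := fun s => M * ‖C‖ * ‖v‖ * Real.exp (-μ * (τ - s)))
      (Eventually.of_forall fun s hs => ?_)
      (Continuous.intervalIntegrable (by fun_prop) _ _)).trans ?_
    · refine ((W (τ - s)).le_of_opNorm_le_of_le (hWn _ (by linarith [hs.2]))
        (C.le_of_opNorm_le_of_le le_rfl (v.norm_coe_le_norm s))).trans (le_of_eq ?_)
      ring
    · rw [intervalIntegral.integral_const_mul]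
      refine (mul_le_mul_of_nonneg_left (hexp τ hτ) (by positivity)).trans (le_of_eq ?_)
      ring
  have hVi : ∀ (v : BoundedContinuousFunction ℝ H) (τ : ℝ),
      IntervalIntegrable (fun s => W (τ - s) (C (v s))) volume 0 τ := fun v τ =>
    (hWc (X := ℝ) (by fun_prop) (by fun_prop)).intervalIntegrable _ _
  let V : BoundedContinuousFunction ℝ H →L[ℂ] BoundedContinuousFunction ℝ H :=
    LinearMap.mkContinuous
      { toFun := fun v => BoundedContinuousFunction.ofNormedAddCommGroup _ (hVc v) _ (hVn v)
        map_add' := fun v w => by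
          ext t
          simp only [BoundedContinuousFunction.coe_ofNormedAddCommGroup,
            BoundedContinuousFunction.coe_add, Pi.add_apply, _root_.map_add]
          exact intervalIntegral.integral_add (hVi v _) (hVi w _)
        map_smul' := fun c v => by
          ext t
          simp only [BoundedContinuousFunction.coe_ofNormedAddCommGroup,
            BoundedContinuousFunction.coe_smul, map_smul, RingHom.id_apply]
          exact intervalIntegral.integral_smul c _ }
      (M * ‖C‖ / μ) fun v =>
        (BoundedContinuousFunction.norm_le (by positivity)).2 fun t => hVn v t
  have hV1 : ‖V‖ < 1 := by
    refine (LinearMap.mkContinuous_norm_le _ (by positivity) _).trans_lt ?_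
    rw [div_lt_one hμ0, hμ]
    exact lt_add_one _
  have hιn : ∀ x : H, ∀ t : ℝ, ‖W t x‖ ≤ M * ‖x‖ := by
    intro x t
    have hWt : W t = W (max t 0) := by simp [hW]
    rw [hWt]
    refine (W _).le_of_opNorm_le ((hWn _ (le_max_right t 0)).trans ?_) x
    refine mul_le_of_le_one_right hM0.le (Real.exp_le_one_iff.2 ?_)
    have : 0 ≤ μ * max t 0 := by positivity
    linarith
  let ι : H →L[ℂ] BoundedContinuousFunction ℝ H :=
    LinearMap.mkContinuous
      { toFun := fun x => BoundedContinuousFunction.ofNormedAddCommGroup (fun t => W t x)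
          (hWc (X := ℝ) continuous_id continuous_const) _ (hιn x)
        map_add' := fun x y => by ext t; simp
        map_smul' := fun c x => by ext t; simp }
      M fun x => (BoundedContinuousFunction.norm_le (by positivity)).2 fun t => hιn x t
  let R : BoundedContinuousFunction ℝ H →L[ℂ] BoundedContinuousFunction ℝ H :=
    ↑(Units.oneSub V hV1)⁻¹
  have hR : ∀ v, R v = v + V (R v) := by
    intro v
    have h1 : (1 - V) * R = 1 := (Units.oneSub V hV1).mul_inv
    have h2 : ((1 - V) * R) v = v := by rw [h1]; rfl
    exact sub_eq_iff_eq_add.1 h2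
  refine ⟨fun t => Real.exp (ℓ * t) •
    (BoundedContinuousFunction.evalCLM ℂ t).comp (R.comp ι), fun x => ?_, fun x t ht => ?_⟩
  · refine Continuous.continuousOn ?_
    have : Continuous (R (ι x)) := (R (ι x)).continuous
    simp only [smul_apply, ContinuousLinearMap.comp_apply,
      BoundedContinuousFunction.evalCLM_apply]
    fun_prop
  · simp only [smul_apply, ContinuousLinearMap.comp_apply,
      BoundedContinuousFunction.evalCLM_apply]
    set u := R (ι x) with hu
    have h1 : u t = W t x + ∫ s in (0 : ℝ)..max t 0, W (max t 0 - s) (C (u s)) :=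
      DFunLike.congr_fun (hR (ι x)) t
    rw [max_eq_left ht] at h1
    rw [h1, smul_add, ← intervalIntegral.integral_smul]
    congr 1
    · simp only [hW, max_eq_left ht, smul_apply]
      rw [smul_smul, ← Real.exp_add]
      simp
    · refine intervalIntegral.integral_congr fun s hs => ?_
      rw [uIcc_of_le ht] at hs
      simp only [hW, max_eq_left (sub_nonneg.2 hs.2), smul_apply]
      rw [smul_smul, ← Real.exp_add, C.map_smul_of_tower, (U (t - s)).map_smul_of_tower]
      congr 2
      ring

/-- The bounded perturbation theorem: `L + C` generates a strongly continuous semigroup, for `L` the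
generator of one and `C` bounded. The new semigroup `G` is related to the old one by the variation
of constants formula. -/
theorem exists_perturbation (hU : IsC0Semigroup U) (C : H →L[ℂ] H) :
    ∃ G : ℝ → H →L[ℂ] H, IsC0Semigroup G ∧
      (∀ x, ∀ t : ℝ, 0 ≤ t → G t x = U t x + ∫ s in (0 : ℝ)..t, U (t - s) (C (G s x))) ∧
      ∀ x y, HasGenerator G x y ↔ HasGenerator U x (y - C x) := by
  obtain ⟨G, hGc, hG⟩ := hU.exists_volterra C
  have hGm : ∀ x, Continuous fun s => G (max s 0) x := fun x =>
    (hGc x).comp_continuous (by fun_prop) fun _ => mem_Ici.2 (le_max_right _ _)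
  have hint : ∀ x (r a b : ℝ),
      IntervalIntegrable (fun s => U (max (r - s) 0) (C (G (max s 0) x))) volume a b :=
    fun x r a b => (hU.continuous_apply_max (by fun_prop)
      (C.continuous.comp (hGm x))).intervalIntegrable _ _
  have hG' : ∀ x, ∀ t : ℝ, 0 ≤ t →
      G t x = U t x + ∫ s in (0 : ℝ)..t, U (max (t - s) 0) (C (G (max s 0) x)) := by
    intro x t ht
    rw [hG x t ht]
    congr 1
    refine intervalIntegral.integral_congr fun s hs => ?_
    rw [uIcc_of_le ht] at hs
    simp [max_eq_left hs.1, max_eq_left (sub_nonneg.2 hs.2)]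
  have hG0 : ∀ x, G 0 x = x := fun x => by simp [hG x 0 le_rfl, hU.map_zero]
  refine ⟨G, ⟨by ext x; simp [hG0], ?_, hGc⟩, hG, ?_⟩
  · -- `τ ↦ G (τ + t) x` and `τ ↦ G τ (G t x)` solve the same Volterra equation
    intro s t hs ht
    ext x
    have hdiff := hU.eq_zero_of_eq_integral C (D := fun τ => G (τ + t) x - G τ (G t x))
      (((hGc x).comp (continuous_add_const t).continuousOn
        fun τ hτ => add_nonneg hτ ht).sub (hGc _)) (fun τ hτ => ?_) hs
    · exact sub_eq_zero.1 hdiff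
    have hsplit : G (τ + t) x = U τ (G t x) +
        ∫ s in (0 : ℝ)..τ, U (max (τ - s) 0) (C (G (max (s + t) 0) x)) := by
      rw [hG' x (τ + t) (add_nonneg hτ ht), hG' x t ht, _root_.map_add,
        ← hU.map_add_apply hτ ht, add_assoc]
      congr 1
      rw [← intervalIntegral.integral_add_adjacent_intervals (hint x (τ + t) 0 t)
        (hint x (τ + t) t (τ + t)),
        ← ContinuousLinearMap.intervalIntegral_comp_comm _ (hint x t 0 t)]
      congr 1
      · refine intervalIntegral.integral_congr fun s hs => ?_
        rw [uIcc_of_le ht] at hs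
        have h1 : 0 ≤ t - s := sub_nonneg.2 hs.2
        simp only [max_eq_left h1]
        rw [← hU.map_add_apply hτ h1, ← add_sub_assoc,
          max_eq_left (by linarith : 0 ≤ τ + t - s)]
      · have h1 := intervalIntegral.integral_comp_add_right (a := 0) (b := τ)
          (fun s => U (max (τ + t - s) 0) (C (G (max s 0) x))) t
        rw [zero_add] at h1
        rw [← h1]
        refine intervalIntegral.integral_congr fun s _ => ?_
        simp only [add_sub_add_right_eq_sub]
    have hshift : Continuous fun s => U (max (τ - s) 0) (C (G (max (s + t) 0) x)) :=
      hU.continuous_apply_max (by fun_prop)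
        (C.continuous.comp ((hGm x).comp (continuous_add_const t)))
    rw [hsplit, hG' (G t x) τ hτ, add_sub_add_left_eq_sub,
      ← intervalIntegral.integral_sub (hshift.intervalIntegrable _ _) (hint _ _ _ _)]
    refine intervalIntegral.integral_congr fun s hs => ?_
    rw [uIcc_of_le hτ] at hs
    simp only [max_eq_left (sub_nonneg.2 hs.2), max_eq_left hs.1,
      max_eq_left (add_nonneg hs.1 ht), map_sub]
  · -- the difference quotients of `G` and `U` differ by a mean value of `s ↦ U (h - s) C G(s) x`
    intro x y
    have hmean : Tendsto (fun h : ℝ => h⁻¹ • ∫ s in (0 : ℝ)..h,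
        U (max (h - s) 0) (C (G (max s 0) x))) (𝓝[>] 0) (𝓝 (C x)) := by
      have hJ : Continuous fun p : ℝ × ℝ =>
          U (max (p.1 - p.1 * p.2) 0) (C (G (max (p.1 * p.2) 0) x)) :=
        hU.continuous_apply_max (by fun_prop)
          (C.continuous.comp ((hGm x).comp (by fun_prop)))
      have hI := intervalIntegral.continuous_parametric_intervalIntegral_of_continuous
        (a₀ := 0) (μ := volume)
        (f := fun h r : ℝ => U (max (h - h * r) 0) (C (G (max (h * r) 0) x)))
        (s := fun _ => 1) hJ continuous_const
      have hI0 := (hI.tendsto 0).mono_left (nhdsWithin_le_nhds (s := Ioi 0))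
      simp only [zero_mul, sub_zero, max_self, hU.map_zero, hG0, one_apply_eq_self,
        intervalIntegral.integral_const, one_smul] at hI0
      refine hI0.congr' ?_
      filter_upwards [self_mem_nhdsWithin] with h hh
      have hh : 0 < h := hh
      have := intervalIntegral.integral_comp_mul_left (a := 0) (b := 1)
        (fun s => U (max (h - s) 0) (C (G (max s 0) x))) hh.ne'
      simpa using this
    have hquot : ∀ᶠ h : ℝ in 𝓝[>] 0, h⁻¹ • (G h x - x) = h⁻¹ • (U h x - x) +
        h⁻¹ • ∫ s in (0 : ℝ)..h, U (max (h - s) 0) (C (G (max s 0) x)) := by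
      filter_upwards [self_mem_nhdsWithin] with h hh
      rw [hG' x h (le_of_lt hh), ← smul_add]
      congr 1
      abel
    constructor
    · intro h
      refine (h.sub hmean).congr' ?_
      filter_upwards [hquot] with r hr
      rw [hr, add_sub_cancel_right]
    · intro h
      have := Tendsto.add h hmean
      rw [sub_add_cancel] at this
      exact this.congr' (hquot.mono fun r hr => hr.symm)

end IsC0Semigroup

/-! ### The operators `QL` and `closure(QL) Q` -/

theorem closure_eq_of_isClosed {A : H →ₗ.[ℂ] H} (hA : A.IsClosed) : A.closure = A := by
  refine LinearPMap.eq_of_eq_graph ?_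
  rw [← hA.isClosable.graph_closure_eq_closure_graph]
  exact IsClosed.submodule_topologicalClosure_eq hA

theorem mem_graph_mulRight {A : H →ₗ.[ℂ] H} {B : H →L[ℂ] H} {p : H × H} :
    p ∈ (mulRight A B).graph ↔ (B p.1, p.2) ∈ A.graph := by
  simp only [LinearPMap.mem_graph_iff]
  constructor
  · rintro ⟨y, h1, h2⟩
    exact ⟨⟨B y, y.2⟩, by rw [← h1], h2⟩
  · rintro ⟨y, h1, h2⟩
    have hy : B p.1 ∈ A.domain := h1 ▸ y.2
    refine ⟨⟨p.1, hy⟩, rfl, ?_⟩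
    rw [← h2]
    exact congrArg A (Subtype.ext h1.symm)

theorem moriQ_apply (z x : H) : moriQ z x = x - moriP z x := rfl

theorem inner_moriQ {z : H} (hz0 : z ≠ 0) (x : H) : inner ℂ z (moriQ z x) = 0 := by
  have hzz : inner ℂ z z ≠ 0 := inner_self_ne_zero.2 hz0
  rw [moriQ_apply, moriP_apply, inner_sub_right, inner_smul_right]
  field_simp
  simp

theorem moriQ_eq_self {z x : H} (hx : inner ℂ z x = 0) : moriQ z x = x := by
  simp [moriQ_apply, moriP_apply, hx]

theorem inner_moriQ_left {z x : H} (hx : inner ℂ z x = 0) (y : H) :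
    inner ℂ (moriQ z y) x = inner ℂ y x := by
  rw [moriQ_apply, moriP_apply, inner_sub_left, inner_smul_left, hx, mul_zero, sub_zero]

/-- The operator `x ↦ (x, y) (z, z)⁻¹ z`. For `y = L† z` it is the bounded extension of `P L`. -/
noncomputable def rankOneP (z y : H) : H →L[ℂ] H := (inner ℂ z z)⁻¹ • (innerSL ℂ y).smulRight z

theorem rankOneP_apply (z y x : H) :
    rankOneP z y x = (inner ℂ y x * (inner ℂ z z)⁻¹) • z := by
  simp [rankOneP, smul_smul, mul_comm]

/-- The bounded operator `x ↦ - (Q x, y) (z, z)⁻¹ z - (x, z) (z, z)⁻¹ y'`. For `y = L† z` and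
`y' = L z` it is the difference of `closure(QL) Q` and `L`. -/
noncomputable def orthPerturbation (z y y' : H) : H →L[ℂ] H :=
  -(rankOneP z y).comp (moriQ z) - (inner ℂ z z)⁻¹ • (innerSL ℂ z).smulRight y'

theorem orthPerturbation_apply (z y y' x : H) : orthPerturbation z y y' x =
    -rankOneP z y (moriQ z x) - (inner ℂ z x * (inner ℂ z z)⁻¹) • y' := by
  simp [orthPerturbation, smul_smul, mul_comm]

theorem orthPerturbation_apply_of_inner_eq_zero {z x : H} (hx : inner ℂ z x = 0) (y y' : H) :
    orthPerturbation z y y' x = -((inner ℂ (moriQ z y) x * (inner ℂ z z)⁻¹) • z) := by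
  rw [orthPerturbation_apply, moriQ_eq_self hx, rankOneP_apply, inner_moriQ_left hx, hx]
  simp

variable [CompleteSpace H] {U : ℝ → H →L[ℂ] H} {z : H}

theorem moriP_generator (hU : IsC0Semigroup U) (hz' : z ∈ (generator U)†.domain) {x y : H}
    (h : HasGenerator U x y) : moriP z y = rankOneP z ((generator U)† ⟨z, hz'⟩) x := by
  have hadj := LinearPMap.adjoint_isFormalAdjoint hU.dense_domain_generator ⟨z, hz'⟩ ⟨x, y, h⟩
  have hxy : generator U ⟨x, y, h⟩ = y := generator_eq_of_hasGenerator h _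
  rw [hxy] at hadj
  rw [moriP_apply, rankOneP_apply]
  exact congrArg (fun c => (c * (inner ℂ z z)⁻¹) • z) hadj.symm

theorem mem_graph_opQL (hU : IsC0Semigroup U) (hz' : z ∈ (generator U)†.domain) {p : H × H} :
    p ∈ (opQL U z).graph ↔
      HasGenerator U p.1 (p.2 + rankOneP z ((generator U)† ⟨z, hz'⟩) p.1) := by
  rw [LinearPMap.mem_graph_iff]
  constructor
  · rintro ⟨x, h1, h2⟩
    have hx : HasGenerator U x (generator U x) := generator_spec U x
    have h3 : generator U x - moriP z (generator U x) = p.2 := h2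
    rw [← h1, ← h3, moriP_generator hU hz' hx, sub_add_cancel]
    exact hx
  · intro h
    refine ⟨⟨p.1, h.mem_domain⟩, rfl, ?_⟩
    change moriQ z (generator U ⟨p.1, h.mem_domain⟩) = p.2
    rw [generator_eq_of_hasGenerator h, moriQ_apply, moriP_generator hU hz' h, add_sub_cancel_right]

/-- `QL` is closed, as the difference of the closed operator `L` and the bounded extension
of `PL`. -/
theorem isClosed_opQL (hU : IsC0Semigroup U) (hz' : z ∈ (generator U)†.domain) :
    (opQL U z).IsClosed := by
  have hset : ((opQL U z).graph : Set (H × H)) =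
      (fun p : H × H => (p.1, p.2 + rankOneP z ((generator U)† ⟨z, hz'⟩) p.1)) ⁻¹'
        (generator U).graph := by
    ext p
    simp only [SetLike.mem_coe, mem_preimage, mem_graph_generator, mem_graph_opQL hU hz']
  rw [LinearPMap.IsClosed, hset]
  exact IsClosed.preimage (by fun_prop) hU.isClosed_generator

/-- `closure(QL) Q` is a bounded perturbation of `L`. -/
theorem mem_graph_opOrth (hU : IsC0Semigroup U) (hz : z ∈ (generator U).domain)
    (hz' : z ∈ (generator U)†.domain) {p : H × H} :
    p ∈ (opOrth U z).graph ↔ HasGenerator U p.1 (p.2 -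
      orthPerturbation z ((generator U)† ⟨z, hz'⟩) (generator U ⟨z, hz⟩) p.1) := by
  rw [opOrth, closure_eq_of_isClosed (isClosed_opQL hU hz'), mem_graph_mulRight,
    mem_graph_opQL hU hz', orthPerturbation_apply]
  have hP := (generator_spec U ⟨z, hz⟩).smul (inner ℂ z p.1 * (inner ℂ z z)⁻¹)
  rw [← moriP_apply] at hP
  constructor
  · intro h
    convert h.add hP using 1
    · simp [moriQ_apply]
    · abel
  · intro h
    convert h.add (hP.smul (-1)) using 1
    · simp [moriQ_apply, sub_eq_add_neg]
    · rw [neg_one_smul]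
      abel

/-- The values of `closure(QL) Q` lie in the range of `Q`. -/
theorem inner_opOrth (hU : IsC0Semigroup U) (hz' : z ∈ (generator U)†.domain) (hz0 : z ≠ 0)
    (x : (opOrth U z).domain) : inner ℂ z (opOrth U z x) = 0 := by
  have key : ∀ p ∈ (opOrth U z).graph, inner ℂ z p.2 = 0 := by
    intro p hp
    rw [opOrth, closure_eq_of_isClosed (isClosed_opQL hU hz'), mem_graph_mulRight,
      LinearPMap.mem_graph_iff] at hp
    obtain ⟨y, -, hy⟩ := hp
    rw [← hy]
    exact inner_moriQ hz0 _
  exact key _ (LinearPMap.mem_graph _ x)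

/-! ### The generalized Langevin equation -/

/-- The semigroup of the orthogonal dynamics. The last clause is the variation of constants
formula for the perturbation `closure(QL) Q` of `L`, on a vector in the range of `Q`: the dynamics
stays in that range, where the perturbation reduces to `x ↦ - (x, Q L† z) (z, z)⁻¹ z`. -/
theorem exists_orthogonal_dynamics (hU : IsC0Semigroup U) (hz : z ∈ (generator U).domain)
    (hz' : z ∈ (generator U)†.domain) (hz0 : z ≠ 0) :
    ∃ G : ℝ → H →L[ℂ] H, IsC0Semigroup G ∧ generator G = opOrth U z ∧
      ∀ w, inner ℂ z w = 0 → ∀ t : ℝ, 0 ≤ t → U t w = G t w + ∫ s in (0 : ℝ)..t,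
        (inner ℂ (moriQ z ((generator U)† ⟨z, hz'⟩)) (G s w) * (inner ℂ z z)⁻¹) • U (t - s) z := by
  obtain ⟨G, hG, hvar, hgen⟩ := hU.exists_perturbation
    (orthPerturbation z ((generator U)† ⟨z, hz'⟩) (generator U ⟨z, hz⟩))
  have hGgen : generator G = opOrth U z := by
    refine LinearPMap.eq_of_eq_graph (Submodule.ext fun p => ?_)
    rw [mem_graph_generator, mem_graph_opOrth hU hz hz', hgen]
  refine ⟨G, hG, hGgen, fun w hw t ht => ?_⟩
  have horth : ∀ s, 0 ≤ s → inner ℂ z (G s w) = 0 := by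
    intro s hs
    have hmild := hG.isMildSolution w
    rw [hGgen] at hmild
    obtain ⟨h, hs'⟩ := hmild.eq_integral s hs
    rw [hs', inner_add_right, hw, inner_opOrth hU hz' hz0, add_zero]
  rw [hvar w t ht, add_assoc, left_eq_add, ← neg_eq_iff_add_eq_zero,
    ← intervalIntegral.integral_neg]
  refine intervalIntegral.integral_congr fun s hs => ?_
  rw [uIcc_of_le ht] at hs
  simp only [orthPerturbation_apply_of_inner_eq_zero (horth s hs.1), map_neg, map_smul, neg_neg]

theorem integral_smul_flip {E : Type*} [NormedAddCommGroup E] [NormedSpace ℂ E]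
    (K : ℝ → ℂ) (u : ℝ → E) (t : ℝ) :
    ∫ s in (0 : ℝ)..t, K (t - s) • u s = ∫ s in (0 : ℝ)..t, K s • u (t - s) := by
  have := intervalIntegral.integral_comp_sub_left (a := 0) (b := t)
    (fun s => K s • u (t - s)) t
  simpa using this

theorem exists_isGLESolution (hU : IsC0Semigroup U) (hz : z ∈ (generator U).domain)
    (hz' : z ∈ (generator U)†.domain) {G : ℝ → H →L[ℂ] H} (hG : IsC0Semigroup G)
    (hvar : ∀ t : ℝ, 0 ≤ t → U t (moriQ z (generator U ⟨z, hz⟩)) =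
      G t (moriQ z (generator U ⟨z, hz⟩)) + ∫ s in (0 : ℝ)..t,
        (inner ℂ (moriQ z ((generator U)† ⟨z, hz'⟩)) (G s (moriQ z (generator U ⟨z, hz⟩))) *
          (inner ℂ z z)⁻¹) • U (t - s) z) :
    IsGLESolution U z hz hz'
      (fun t => inner ℂ (moriQ z ((generator U)† ⟨z, hz'⟩))
        (G t (moriQ z (generator U ⟨z, hz⟩))) * (inner ℂ z z)⁻¹)
      fun t => G t (moriQ z (generator U ⟨z, hz⟩)) where
  integrable t ht := by
    refine ContinuousOn.intervalIntegrable ?_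
    have hη : ContinuousOn (fun s => G s (moriQ z (generator U ⟨z, hz⟩))) (uIcc 0 t) :=
      (hG.continuousOn_orbit _).mono fun s hs => by rw [uIcc_of_le ht] at hs; exact hs.1
    exact ((innerSL ℂ _).continuous.comp_continuousOn hη).mul continuousOn_const
  gle t ht := by
    have h1 : generator U ⟨z, hz⟩ =
        moriP z (generator U ⟨z, hz⟩) + moriQ z (generator U ⟨z, hz⟩) := by
      rw [moriQ_apply, add_sub_cancel]
    have h2 : U t (generator U ⟨z, hz⟩) =
        U t (moriP z (generator U ⟨z, hz⟩)) + U t (moriQ z (generator U ⟨z, hz⟩)) := by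
      rw [← map_add, ← h1]
    rw [integral_smul_flip (fun t => inner ℂ (moriQ z ((generator U)† ⟨z, hz'⟩))
      (G t (moriQ z (generator U ⟨z, hz⟩))) * (inner ℂ z z)⁻¹) (fun s => U s z),
      add_assoc, ← hvar t ht, ← h2]
    exact hU.hasDerivWithinAt_orbit (generator_spec U ⟨z, hz⟩) ht
  fdt t _ := rfl

theorem IsGLESolution.intervalIntegrable_memory (hU : IsC0Semigroup U)
    {hz : z ∈ (generator U).domain} {hz' : z ∈ (generator U)†.domain} {K : ℝ → ℂ} {η : ℝ → H}
    (h : IsGLESolution U z hz hz' K η) {t : ℝ} (ht : 0 ≤ t) :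
    IntervalIntegrable (fun s => K s • U (t - s) z) volume 0 t := by
  refine (h.integrable t ht).smul_continuousOn ((hU.continuousOn_orbit z).comp (by fun_prop)
    fun s hs => ?_)
  rw [uIcc_of_le ht] at hs
  exact sub_nonneg.2 hs.2

/-- The fluctuating forces are unique: the difference of two solutions satisfies
`‖η - η'‖ ≤ M ∫ |K - K'|` and `|K - K'| ≤ c ‖η - η'‖`. -/
theorem IsGLESolution.eq (hU : IsC0Semigroup U) {hz : z ∈ (generator U).domain}
    {hz' : z ∈ (generator U)†.domain} {K K' : ℝ → ℂ} {η η' : ℝ → H}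
    (h : IsGLESolution U z hz hz' K η) (h' : IsGLESolution U z hz hz' K' η') {t : ℝ}
    (ht : 0 ≤ t) : η t = η' t := by
  obtain ⟨M, hM1, hM⟩ := hU.exists_norm_le t
  set A := moriQ z ((generator U)† ⟨z, hz'⟩)
  have hdiff : ∀ r, 0 ≤ r → η r - η' r = -∫ s in (0 : ℝ)..r, (K s - K' s) • U (r - s) z := by
    intro r hr
    have h1 := (uniqueDiffOn_Ici (0 : ℝ) r hr).eq_deriv _ (h.gle r hr) (h'.gle r hr)
    rw [integral_smul_flip K (fun s => U s z), integral_smul_flip K' (fun s => U s z),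
      add_assoc, add_assoc, add_right_inj] at h1
    simp_rw [sub_smul]
    rw [intervalIntegral.integral_sub (h.intervalIntegrable_memory hU hr)
      (h'.intervalIntegrable_memory hU hr), neg_sub, sub_eq_sub_iff_add_eq_add, h1, add_comm]
  have hint : ∀ r, 0 ≤ r → IntervalIntegrable (fun s => ‖K s - K' s‖) volume 0 r :=
    fun r hr => ((h.integrable r hr).sub (h'.integrable r hr)).norm
  have hηle : ∀ r ∈ Icc 0 t, ‖η r - η' r‖ ≤ M * ‖z‖ * ∫ s in (0 : ℝ)..r, ‖K s - K' s‖ := by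
    intro r hr
    rw [hdiff r hr.1, norm_neg, ← intervalIntegral.integral_const_mul]
    refine intervalIntegral.norm_integral_le_of_norm_le hr.1
      (Eventually.of_forall fun s hs => ?_) ((hint r hr.1).const_mul _)
    rw [norm_smul, mul_comm]
    exact mul_le_mul_of_nonneg_right ((U (r - s)).le_of_opNorm_le
      (hM _ ⟨by linarith [hs.2], by linarith [hs.1, hr.2]⟩) z) (norm_nonneg _)
  have hKle : ∀ r, 0 ≤ r → ‖K r - K' r‖ ≤ ‖A‖ * ‖(inner ℂ z z)⁻¹‖ * ‖η r - η' r‖ := by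
    intro r hr
    rw [h.fdt r hr, h'.fdt r hr, ← sub_mul, ← inner_sub_right, norm_mul, mul_right_comm]
    exact mul_le_mul_of_nonneg_right (norm_inner_le_norm _ _) (norm_nonneg _)
  have hK : ∀ r ∈ Icc 0 t, ‖K r - K' r‖ = 0 := fun r hr =>
    eq_zero_of_le_mul_integral (φ := fun s => ‖K s - K' s‖)
      (M := ‖A‖ * ‖(inner ℂ z z)⁻¹‖ * (M * ‖z‖)) (by positivity) (fun _ _ => norm_nonneg _)
      (hint t ht) (fun r hr => (hKle r hr.1).trans (by
        rw [mul_assoc (‖A‖ * _)]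
        exact mul_le_mul_of_nonneg_left (hηle r hr) (by positivity))) hr
  have h0 : ∫ s in (0 : ℝ)..t, ‖K s - K' s‖ = 0 := by
    rw [intervalIntegral.integral_congr (g := fun _ => (0 : ℝ)) fun r hr => hK r (by
      rwa [uIcc_of_le ht] at hr)]
    simp
  have := hηle t ⟨ht, le_rfl⟩
  rw [h0, mul_zero] at this
  exact sub_eq_zero.1 (norm_le_zero_iff.1 this)

end MoriGLE

theorem mainTheorem6 {H : Type*} [NormedAddCommGroup H] [InnerProductSpace ℂ H] [CompleteSpace H]
    (U : ℝ → H →L[ℂ] H) (hU : MoriGLE.IsC0Semigroup U) (z : H)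
    (hz : z ∈ (MoriGLE.generator U).domain) (hz' : z ∈ (MoriGLE.generator U)†.domain)
    (hz0 : z ≠ 0) :
    -- `QL` is closable, and `closure(QL) Q` generates a strongly continuous semigroup
    (MoriGLE.opQL U z).IsClosable ∧
    (∃ G : ℝ → H →L[ℂ] H, MoriGLE.IsC0Semigroup G ∧ MoriGLE.generator G = MoriGLE.opOrth U z) ∧
    -- the memory kernel and the fluctuating forces exist
    (∃ (K : ℝ → ℂ) (η : ℝ → H), MoriGLE.IsGLESolution U z hz hz' K η) ∧
    -- and the fluctuating forces are given by the orthogonal dynamics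
    (∀ (K : ℝ → ℂ) (η : ℝ → H), MoriGLE.IsGLESolution U z hz hz' K η →
      (∀ G : ℝ → H →L[ℂ] H, MoriGLE.IsC0Semigroup G →
        MoriGLE.generator G = MoriGLE.opOrth U z →
        ∀ t : ℝ, 0 ≤ t → η t = G t (MoriGLE.moriQ z (MoriGLE.generator U ⟨z, hz⟩))) ∧
      η 0 = MoriGLE.moriQ z (MoriGLE.generator U ⟨z, hz⟩) ∧
      MoriGLE.IsMildSolution (MoriGLE.opOrth U z) (η 0) η ∧
      ∀ v : ℝ → H, MoriGLE.IsMildSolution (MoriGLE.opOrth U z) (η 0) v →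
        ∀ t : ℝ, 0 ≤ t → v t = η t) := by
  obtain ⟨G, hG, hGgen, hvar⟩ := MoriGLE.exists_orthogonal_dynamics hU hz hz' hz0
  have hsol := MoriGLE.exists_isGLESolution hU hz hz' hG (hvar _ (MoriGLE.inner_moriQ hz0 _))
  refine ⟨(MoriGLE.isClosed_opQL hU hz').isClosable, ⟨G, hG, hGgen⟩, ⟨_, _, hsol⟩,
    fun K η hη => ?_⟩
  have hηG : ∀ t : ℝ, 0 ≤ t → η t = G t (MoriGLE.moriQ z (MoriGLE.generator U ⟨z, hz⟩)) :=
    fun t ht => hη.eq hU hsol ht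
  have hη0 : η 0 = MoriGLE.moriQ z (MoriGLE.generator U ⟨z, hz⟩) := by
    rw [hηG 0 le_rfl, hG.map_zero]
    rfl
  have hmild : MoriGLE.IsMildSolution (MoriGLE.opOrth U z) (η 0) η := by
    rw [hη0, ← hGgen]
    exact (hG.isMildSolution _).congr hηG
  refine ⟨fun G' hG' hgen' t ht => ?_, hη0, hmild, fun v hv t ht => ?_⟩
  · rw [← hη0]
    exact hG'.eq_of_isMildSolution (hgen' ▸ hmild) ht
  · rw [← hGgen] at hv hmild
    rw [hG.eq_of_isMildSolution hv ht, hG.eq_of_isMildSolution hmild ht]
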